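/- Let $\alpha>0$ and let $\mathbb D=\{z\in\mathbb C:|z|<1\}$. For a proper simply connected domain $\Omega\subsetneq\mathbb C$ containing $\mathbb D$, let $\lambda_\Omega(z)=|\varphi'(z)|/(1-|\varphi(z)|^2)$ be its hyperbolic density, where $\varphi$ is a conformal mapping of $\Omega$ onto $\mathbb D$ (the value does not depend on $\varphi$). Let $\mathcal B_\Omega(\alpha)$ be the space of analytic functions $f$ on $\Omega$ with $\sup_{z\in\Omega}|f'(z)|/\lambda_\Omega(z)^\alpha<\infty$, with norm $\|f\|_{\Omega,\alpha}=|f(0)|+\sup_{z\in\Omega}|f'(z)|/\lambda_\Omega(z)^\alpha$. The Bloch–Bohr radius for $\mathcal B_\Omega(\alpha)$ is the largest $r\in(0,1)$, if it exists, such that $\sum_{n=0}^\infty|a_n|\rho^n\le 1$ for all $0\le\rho\le r$ and all $f\in\mathcal B_\Omega(\alpha)$ with $\|f\|_{\Omega,\alpha}\le 1$ and $f(z)=\sum_{n=0}^\infty a_nz^n$ in $\mathbb D$. (1) Let $\Omega_1\subseteq\Omega_2$ be proper simply connected domains in $\mathbb C$ containing $\mathbb D$. If the Bloch–Bohr radii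 $r_1$ for $\mathcal B_{\Omega_1}(\alpha)$ and $r_2$ for $\mathcal B_{\Omega_2}(\alpha)$ exist, then $r_1\le r_2$. (2) Let $\Omega_1\subseteq\Omega_2\subseteq\cdots\subseteq\Omega_n$ be finitely many proper simply connected domains in $\mathbb C$ containing $\mathbb D$. If the Bloch–Bohr radius $r_i$ for $\mathcal B_{\Omega_i}(\alpha)$ exists for every $i=1,\dots,n$, then $r_1\le r_2\le\cdots\le r_n$. -/

import Mathlib

namespace BlochBohr

open Metric Set

/-- A proper simply connected domain of `ℂ`: open, simply connected (hence non-empty and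
path-connected) and different from `ℂ`. -/
structure IsProperSimplyConnectedDomain (Ω : Set ℂ) : Prop where
  isOpen : IsOpen Ω
  isSimplyConnected : IsSimplyConnected Ω
  ne_univ : Ω ≠ univ

/-- `φ` is a conformal mapping of `Ω` onto the open unit disk. -/
def IsConformalOntoDisk (Ω : Set ℂ) (φ : ℂ → ℂ) : Prop :=
  DifferentiableOn ℂ φ Ω ∧ BijOn φ Ω (ball 0 1)

/-- The density of the hyperbolic metric of the unit disk, `1 / (1 - |z|²)`. -/
noncomputable def diskDensity (z : ℂ) : ℝ := 1 / (1 - ‖z‖ ^ 2)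

open Classical in
/-- The hyperbolic density of `Ω`: `diskDensity (φ z) * |φ' z|` for a conformal mapping `φ` of `Ω`
onto the unit disk. Such a `φ` exists for every proper simply connected domain (Riemann mapping
theorem), and the value at points of `Ω` does not depend on the chosen `φ`. The default value `0`
is used only for sets `Ω` that are not conformally equivalent to the disk. -/
noncomputable def hyperbolicDensity (Ω : Set ℂ) (z : ℂ) : ℝ :=
  if h : ∃ φ : ℂ → ℂ, IsConformalOntoDisk Ω φ then
    diskDensity (h.choose z) * ‖deriv h.choose z‖
  else 0

/-- The quotient `|f'(z)| / λ_Ω(z) ^ α`. -/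
noncomputable def blochQuotient (Ω : Set ℂ) (α : ℝ) (f : ℂ → ℂ) (z : ℂ) : ℝ :=
  ‖deriv f z‖ / hyperbolicDensity Ω z ^ α

/-- The `α`-Bloch space of `Ω`: functions analytic in `Ω` with
`sup_{z ∈ Ω} |f'(z)| / λ_Ω(z) ^ α < ∞`. Only the values of `f` on `Ω` matter. -/
def blochSpace (Ω : Set ℂ) (α : ℝ) : Set (ℂ → ℂ) :=
  {f | DifferentiableOn ℂ f Ω ∧ BddAbove (blochQuotient Ω α f '' Ω)}

/-- The Bloch norm `|f(0)| + sup_{z ∈ Ω} |f'(z)| / λ_Ω(z) ^ α`, for `f` in the Bloch space. -/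
noncomputable def blochNorm (Ω : Set ℂ) (α : ℝ) (f : ℂ → ℂ) : ℝ :=
  ‖f 0‖ + sSup (blochQuotient Ω α f '' Ω)

/-- The Bohr inequality `∑ |a_n| ρ ^ n ≤ 1` holds for all `ρ ∈ [0, r]` and all `f` in the closed
unit ball of the Bloch space, where `f(z) = ∑ a_n z ^ n` in the unit disk. -/
def BohrInequalityUpTo (Ω : Set ℂ) (α r : ℝ) : Prop :=
  ∀ f ∈ blochSpace Ω α, blochNorm Ω α f ≤ 1 →
    ∀ a : ℕ → ℂ, (∀ z ∈ ball (0 : ℂ) 1, HasSum (fun n : ℕ => a n * z ^ n) (f z)) →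
      ∀ ρ : ℝ, 0 ≤ ρ → ρ ≤ r →
        Summable (fun n : ℕ => ‖a n‖ * ρ ^ n) ∧ ∑' n : ℕ, ‖a n‖ * ρ ^ n ≤ 1

/-- The Bloch-Bohr radius of the `α`-Bloch space of `Ω` exists and is equal to `r`: `r` is the
largest number in `(0, 1)` up to which the Bohr inequality holds. -/
def IsBlochBohrRadius (Ω : Set ℂ) (α r : ℝ) : Prop :=
  IsGreatest {s : ℝ | 0 < s ∧ s < 1 ∧ BohrInequalityUpTo Ω α s} r

end BlochBohr

open Metric Set Filter Topology ComplexConjugate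

namespace BlochBohr

/-! ### Injective holomorphic functions -/

section Injective

variable {U : Set ℂ} {f : ℂ → ℂ} {z : ℂ}

/-! Enlarging the domain shrinks the hyperbolic density: a conformal map of `Ω₂` onto the disk,
restricted to `Ω₁` and composed with the inverse of a conformal map of `Ω₁`, is a self-map of the
disk, which Schwarz–Pick makes a contraction (`hyperbolicDensity_anti`). Since `α ≥ 0`, the Bloch
norm over `Ω₁` is at most that over `Ω₂`, so the unit ball for `Ω₂` lies in the one for `Ω₁`. A Bohr
inequality for `Ω₁` therefore passes to `Ω₂`; chains follow pairwise.

The density is defined through a chosen conformal map, with default `0`, so the argument needs the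
Riemann mapping theorem. It is proved by maximising `‖deriv f z₀‖` over univalent maps into the
disk: a maximiser that omitted a value could be improved by a square root. -/

theorem not_eventually_const_of_injOn (hU : IsOpen U) (hi : InjOn f U) (hz : z ∈ U) (c : ℂ) :
    ¬ ∀ᶠ w in 𝓝 z, f w = c := by
  intro h
  have h1 : ∀ᶠ w in 𝓝 z, w = z := by
    filter_upwards [h, hU.mem_nhds hz] with w hw hwU
    exact hi hwU hz (hw.trans h.self_of_nhds.symm)
  have h2 : ∃ᶠ w in 𝓝[≠] z, w ≠ z := (eventually_mem_nhdsWithin (s := {z}ᶜ)).frequently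
  exact h2 ((h1.filter_mono nhdsWithin_le_nhds).mono fun w hw => not_not.mpr hw)

theorem nhds_le_map_nhds_of_injOn (hU : IsOpen U) (hf : DifferentiableOn ℂ f U) (hi : InjOn f U)
    (hz : z ∈ U) : 𝓝 (f z) ≤ map f (𝓝 z) :=
  (hf.analyticAt (hU.mem_nhds hz)).eventually_constant_or_nhds_le_map_nhds_aux.resolve_left
    (not_eventually_const_of_injOn hU hi hz _)

theorem invFunOn_eventually_leftInverse (hU : IsOpen U) (hi : InjOn f U) (hz : z ∈ U) :
    ∀ᶠ w in 𝓝 z, Function.invFunOn f U (f w) = w := by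
  filter_upwards [hU.mem_nhds hz] with w hw
  exact hi.leftInvOn_invFunOn hw

theorem continuousAt_invFunOn (hU : IsOpen U) (hf : DifferentiableOn ℂ f U) (hi : InjOn f U)
    (hz : z ∈ U) : ContinuousAt (Function.invFunOn f U) (f z) := by
  have h := invFunOn_eventually_leftInverse hU hi hz
  rw [ContinuousAt, hi.leftInvOn_invFunOn hz]
  refine Tendsto.mono_left ?_ (nhds_le_map_nhds_of_injOn hU hf hi hz)
  rw [tendsto_map'_iff]
  exact tendsto_id.congr' (h.mono fun w hw => hw.symm)

theorem eventually_rightInverse_invFunOn (hU : IsOpen U) (hf : DifferentiableOn ℂ f U)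
    (hi : InjOn f U) (hz : z ∈ U) : ∀ᶠ w in 𝓝 (f z), f (Function.invFunOn f U w) = w := by
  filter_upwards [nhds_le_map_nhds_of_injOn hU hf hi hz (image_mem_map (hU.mem_nhds hz))] with w hw
  exact Function.invFunOn_eq hw

theorem differentiableAt_invFunOn_of_deriv_ne_zero (hU : IsOpen U) (hf : DifferentiableOn ℂ f U)
    (hi : InjOn f U) (hz : z ∈ U) (hd : deriv f z ≠ 0) :
    DifferentiableAt ℂ (Function.invFunOn f U) (f z) := by
  refine (HasDerivAt.of_local_left_inverse (f := f) (f' := deriv f z)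
    (continuousAt_invFunOn hU hf hi hz) ?_ hd
    (eventually_rightInverse_invFunOn hU hf hi hz)).differentiableAt
  rw [hi.leftInvOn_invFunOn hz]
  exact (hf.differentiableAt (hU.mem_nhds hz)).hasDerivAt

theorem eventually_deriv_ne_zero_of_injOn (hU : IsOpen U) (hf : DifferentiableOn ℂ f U)
    (hi : InjOn f U) (hz : z ∈ U) : ∀ᶠ w in 𝓝[≠] z, deriv f w ≠ 0 := by
  refine (hf.analyticAt (hU.mem_nhds hz)).deriv.eventually_eq_zero_or_eventually_ne_zero.resolve_left
    fun h => ?_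
  obtain ⟨R, hR, hball⟩ := Metric.eventually_nhds_iff_ball.mp (h.and (hU.mem_nhds hz))
  refine not_eventually_const_of_injOn hU hi hz (f z) ?_
  filter_upwards [ball_mem_nhds z hR] with w hw
  exact (convex_ball z R).is_const_of_fderivWithin_eq_zero (𝕜 := ℂ)
    (hf.mono fun y hy => (hball y hy).2)
    (fun y hy => by
      rw [fderivWithin_of_isOpen isOpen_ball hy]
      ext
      simpa using (hball y hy).1) hw (mem_ball_self hR)

/-- The inverse of an injective holomorphic function is holomorphic. -/
theorem differentiableAt_invFunOn (hU : IsOpen U) (hf : DifferentiableOn ℂ f U) (hi : InjOn f U)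
    (hz : z ∈ U) : DifferentiableAt ℂ (Function.invFunOn f U) (f z) := by
  -- Critical points are isolated, so the inverse is holomorphic near `f z` except perhaps at `f z`,
  -- where continuity makes the singularity removable.
  refine (Complex.analyticAt_of_differentiable_on_punctured_nhds_of_continuousAt ?_
    (continuousAt_invFunOn hU hf hi hz)).differentiableAt
  have h1 : ∀ᶠ w in 𝓝 z, w ≠ z → deriv f w ≠ 0 :=
    eventually_nhdsWithin_iff.mp (eventually_deriv_ne_zero_of_injOn hU hf hi hz)
  have h2 : f '' {w | w ∈ U ∧ (w ≠ z → deriv f w ≠ 0)} ∈ 𝓝 (f z) :=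
    nhds_le_map_nhds_of_injOn hU hf hi hz (image_mem_map ((hU.eventually_mem hz).and h1))
  rw [eventually_nhdsWithin_iff]
  filter_upwards [h2]
  rintro _ ⟨w, ⟨hw, hd⟩, rfl⟩ hne
  exact differentiableAt_invFunOn_of_deriv_ne_zero hU hf hi hw (hd fun h => hne (by simp [h]))

/-- The derivative of an injective holomorphic function does not vanish. -/
theorem deriv_ne_zero_of_injOn (hU : IsOpen U) (hf : DifferentiableOn ℂ f U) (hi : InjOn f U)
    (hz : z ∈ U) : deriv f z ≠ 0 := by
  intro h0
  have h1 := (differentiableAt_invFunOn hU hf hi hz).hasDerivAt.comp z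
    (hf.differentiableAt (hU.mem_nhds hz)).hasDerivAt
  have h2 := (hasDerivAt_id z).congr_of_eventuallyEq (invFunOn_eventually_leftInverse hU hi hz)
  have h3 := h1.unique h2
  simp [h0] at h3

end Injective

/-! ### Automorphisms of the disk and the Schwarz–Pick lemma -/

section Disk

/-- The automorphism `z ↦ (z - w) / (1 - conj w * z)` of the unit disk. -/
noncomputable def mobius (w z : ℂ) : ℂ := (z - w) / (1 - conj w * z)

/-- The density at `z` of the pullback of the hyperbolic metric of the disk under `f`. -/
noncomputable def pullbackDensity (f : ℂ → ℂ) (z : ℂ) : ℝ := diskDensity (f z) * ‖deriv f z‖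

variable {w z : ℂ}

theorem one_sub_normSq_pos (hz : z ∈ ball (0 : ℂ) 1) : 0 < 1 - ‖z‖ ^ 2 := by
  rw [mem_ball_zero_iff] at hz
  nlinarith [norm_nonneg z]

theorem diskDensity_pos (hz : z ∈ ball (0 : ℂ) 1) : 0 < diskDensity z :=
  one_div_pos.mpr (one_sub_normSq_pos hz)

theorem one_sub_conj_mul_ne_zero (hw : w ∈ ball (0 : ℂ) 1) (hz : z ∈ ball (0 : ℂ) 1) :
    1 - conj w * z ≠ 0 := by
  rw [mem_ball_zero_iff] at hw hz
  intro h
  have h1 : ‖conj w * z‖ = 1 := by rw [← sub_eq_zero.mp h, norm_one]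
  rw [norm_mul, RCLike.norm_conj] at h1
  nlinarith [norm_nonneg w, norm_nonneg z]

theorem one_sub_norm_mobius_sq (hw : w ∈ ball (0 : ℂ) 1) (hz : z ∈ ball (0 : ℂ) 1) :
    1 - ‖mobius w z‖ ^ 2 = (1 - ‖w‖ ^ 2) * (1 - ‖z‖ ^ 2) / ‖1 - conj w * z‖ ^ 2 := by
  have h := norm_ne_zero_iff.mpr (one_sub_conj_mul_ne_zero hw hz)
  rw [mobius, norm_div, div_pow, eq_div_iff (by positivity), sub_mul, div_mul_cancel₀ _ (by positivity)]
  simp only [← Complex.normSq_eq_norm_sq, Complex.normSq_apply, Complex.sub_re, Complex.sub_im,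
    Complex.mul_re, Complex.mul_im, Complex.conj_re, Complex.conj_im, Complex.one_re,
    Complex.one_im]
  ring

theorem mobius_mem_ball (hw : w ∈ ball (0 : ℂ) 1) (hz : z ∈ ball (0 : ℂ) 1) :
    mobius w z ∈ ball (0 : ℂ) 1 := by
  have h := norm_pos_iff.mpr (one_sub_conj_mul_ne_zero hw hz)
  have h1 : 0 < 1 - ‖mobius w z‖ ^ 2 := by
    rw [one_sub_norm_mobius_sq hw hz]
    have := one_sub_normSq_pos hw
    have := one_sub_normSq_pos hz
    positivity
  rw [mem_ball_zero_iff]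
  nlinarith [norm_nonneg (mobius w z)]

theorem mobius_self (w : ℂ) : mobius w w = 0 := by simp [mobius]

theorem mobius_neg_zero (w : ℂ) : mobius (-w) 0 = w := by simp [mobius]

theorem hasDerivAt_mobius (hw : w ∈ ball (0 : ℂ) 1) (hz : z ∈ ball (0 : ℂ) 1) :
    HasDerivAt (mobius w) ((1 - ‖w‖ ^ 2 : ℝ) / (1 - conj w * z) ^ 2) z := by
  have h := one_sub_conj_mul_ne_zero hw hz
  have h1 : HasDerivAt (fun z : ℂ => 1 - conj w * z) (-(conj w)) z := by
    simpa using ((hasDerivAt_id z).const_mul (conj w)).const_sub 1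
  refine (((hasDerivAt_id z).sub_const w).div h1 h).congr_deriv ?_
  have h2 : conj w * w = ((‖w‖ ^ 2 : ℝ) : ℂ) := by
    rw [mul_comm, Complex.mul_conj, Complex.normSq_eq_norm_sq]
  rw [Complex.ofReal_sub, ← h2]
  simp only [id, Complex.ofReal_one]
  congr 1
  ring

theorem injOn_mobius (hw : w ∈ ball (0 : ℂ) 1) : InjOn (mobius w) (ball 0 1) := by
  intro x hx y hy h
  rw [mobius, mobius, div_eq_div_iff (one_sub_conj_mul_ne_zero hw hx)
    (one_sub_conj_mul_ne_zero hw hy)] at h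
  have h3 : (x - y) * (1 - conj w * w) = 0 := by linear_combination h
  exact sub_eq_zero.mp ((mul_eq_zero.mp h3).resolve_right (one_sub_conj_mul_ne_zero hw hw))

/-- The factor `‖1 - conj w * z‖ ^ 2` of `one_sub_norm_mobius_sq` cancels against the derivative. -/
theorem pullbackDensity_mobius (hw : w ∈ ball (0 : ℂ) 1) (hz : z ∈ ball (0 : ℂ) 1) :
    pullbackDensity (mobius w) z = diskDensity z := by
  have h := norm_pos_iff.mpr (one_sub_conj_mul_ne_zero hw hz)
  have h1 := one_sub_normSq_pos hw
  have h2 := one_sub_normSq_pos hz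
  rw [pullbackDensity, (hasDerivAt_mobius hw hz).deriv, diskDensity, one_sub_norm_mobius_sq hw hz,
    norm_div, norm_pow, Complex.norm_real, Real.norm_of_nonneg h1.le, diskDensity]
  field_simp

theorem pullbackDensity_comp {f g : ℂ → ℂ} (hg : DifferentiableAt ℂ g (f z))
    (hf : DifferentiableAt ℂ f z) :
    pullbackDensity (g ∘ f) z = pullbackDensity g (f z) * ‖deriv f z‖ := by
  rw [pullbackDensity, deriv_comp z hg hf, norm_mul, ← mul_assoc, pullbackDensity,
    Function.comp_apply]

theorem pullbackDensity_mobius_comp {f : ℂ → ℂ} (hw : w ∈ ball (0 : ℂ) 1)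
    (hz : f z ∈ ball (0 : ℂ) 1) (hf : DifferentiableAt ℂ f z) :
    pullbackDensity (mobius w ∘ f) z = pullbackDensity f z := by
  rw [pullbackDensity_comp (hasDerivAt_mobius hw hz).differentiableAt hf,
    pullbackDensity_mobius hw hz, pullbackDensity]

/-- The **Schwarz–Pick lemma**. -/
theorem pullbackDensity_le_diskDensity {ψ : ℂ → ℂ} (hd : DifferentiableOn ℂ ψ (ball 0 1))
    (hm : MapsTo ψ (ball 0 1) (ball 0 1)) (hz : z ∈ ball (0 : ℂ) 1) :
    pullbackDensity ψ z ≤ diskDensity z := by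
  have h0 : (0 : ℂ) ∈ ball (0 : ℂ) 1 := mem_ball_self one_pos
  have hz' : -z ∈ ball (0 : ℂ) 1 := by simpa using hz
  have hdψ := hd.differentiableAt (isOpen_ball.mem_nhds hz)
  have hm' := hasDerivAt_mobius hz' h0
  -- Automorphisms move `z` and `ψ z` to `0`, where the Schwarz lemma applies; their invariance
  -- carries the bound back.
  set G := mobius (ψ z) ∘ ψ ∘ mobius (-z) with hG
  have hGd : DifferentiableOn ℂ G (ball 0 1) := by
    intro x hx
    have hx1 := mobius_mem_ball hz' hx
    exact ((hasDerivAt_mobius (hm hz) (hm hx1)).differentiableAt.comp x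
      ((hd.differentiableAt (isOpen_ball.mem_nhds hx1)).comp x
        (hasDerivAt_mobius hz' hx).differentiableAt)).differentiableWithinAt
  have hG0 : G 0 = 0 := by simp [hG, mobius_neg_zero, mobius_self]
  have hGm : MapsTo G (ball 0 1) (closedBall (G 0) 1) := by
    intro x hx
    rw [hG0]
    exact ball_subset_closedBall (mobius_mem_ball (hm hz) (hm (mobius_mem_ball hz' hx)))
  have h1 := Complex.norm_deriv_le_one_of_mapsTo_ball hGd hGm one_pos
  have h2 : pullbackDensity G 0 = ‖deriv G 0‖ := by
    simp [pullbackDensity, hG0, diskDensity]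
  have hin : DifferentiableAt ℂ (ψ ∘ mobius (-z)) 0 :=
    DifferentiableAt.comp 0 (by rwa [mobius_neg_zero]) hm'.differentiableAt
  rw [← h2, hG, pullbackDensity_mobius_comp (f := ψ ∘ mobius (-z)) (hm hz)
      (hm (mobius_mem_ball hz' h0)) hin,
    pullbackDensity_comp (by rwa [mobius_neg_zero]) hm'.differentiableAt, mobius_neg_zero,
    hm'.deriv, map_neg, neg_mul, mul_zero, neg_zero, sub_zero, one_pow, div_one, norm_neg,
    Complex.norm_real, Real.norm_of_nonneg (one_sub_normSq_pos hz).le] at h1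
  rw [diskDensity, le_div_iff₀ (one_sub_normSq_pos hz)]
  exact h1

end Disk


/-! ### The Riemann mapping theorem -/

section RiemannMapping

variable {U : Set ℂ} {z₀ : ℂ}

/-- A pointwise limit of holomorphic maps into the unit disk is a locally uniform limit. -/
theorem tendstoLocallyUniformlyOn_of_mapsTo_ball {ι : Type*} {l : Filter ι} [l.NeBot]
    {F : ι → ℂ → ℂ} {f : ℂ → ℂ} (hU : IsOpen U) (hF : ∀ i, DifferentiableOn ℂ (F i) U)
    (hm : ∀ i, MapsTo (F i) U (ball 0 1)) (hl : ∀ z ∈ U, Tendsto (F · z) l (𝓝 (f z))) :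
    TendstoLocallyUniformlyOn F f l U := by
  rw [Metric.tendstoLocallyUniformlyOn_iff]
  intro ε hε x hx
  obtain ⟨R, hR, hball⟩ := Metric.isOpen_iff.mp hU x hx
  -- The Lipschitz constant does not depend on `i`: this equicontinuity upgrades pointwise
  -- convergence.
  have hlip : ∀ i, ∀ y ∈ ball x R, dist (F i y) (F i x) ≤ 2 / R * dist y x := by
    intro i y hy
    refine Complex.dist_le_div_mul_dist_of_mapsTo_ball ((hF i).mono hball) (fun w hw => ?_) hy
    have h1 := mem_ball_zero_iff.mp (hm i (hball hw))
    have h2 := mem_ball_zero_iff.mp (hm i hx)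
    rw [mem_closedBall, dist_eq_norm]
    linarith [norm_sub_le (F i w) (F i x)]
  have hlip' : ∀ y ∈ ball x R, dist (f y) (f x) ≤ 2 / R * dist y x := fun y hy =>
    le_of_tendsto ((hl y (hball hy)).dist (hl x hx)) (Eventually.of_forall fun i => hlip i y hy)
  refine ⟨ball x (min R (ε * R / 8)),
    mem_nhdsWithin_of_mem_nhds (ball_mem_nhds x (by positivity)), ?_⟩
  filter_upwards [Metric.tendsto_nhds.mp (hl x hx) (ε / 4) (by positivity)] with i hi y hy
  rw [mem_ball, lt_min_iff] at hy
  have h1 := hlip i y hy.1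
  have h2 := hlip' y hy.1
  have h3 : 2 / R * dist y x ≤ ε / 4 := by
    rw [div_mul_eq_mul_div, div_le_iff₀ hR]
    linarith [hy.2]
  have h4 := dist_triangle4 (f y) (f x) (F i x) (F i y)
  rw [dist_comm (f x) (F i x), dist_comm (F i x) (F i y)] at h4
  linarith

/-- **Hurwitz's theorem**: a locally uniform limit of injective holomorphic functions on a connected
open set is injective unless it is constant. -/
theorem injOn_of_tendstoLocallyUniformlyOn {ι : Type*} {l : Filter ι} [l.NeBot]
    {F : ι → ℂ → ℂ} {f : ℂ → ℂ} (hU : IsOpen U) (hc : IsPreconnected U)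
    (hF : ∀ i, DifferentiableOn ℂ (F i) U) (hi : ∀ i, InjOn (F i) U)
    (hl : TendstoLocallyUniformlyOn F f l U) (hne : ∀ c, ¬ EqOn f (fun _ => c) U) :
    InjOn f U := by
  have hf : DifferentiableOn ℂ f U := hl.differentiableOn (Eventually.of_forall hF) hU
  intro a ha b hb hab
  by_contra hne'
  have hiso : ∀ᶠ z in 𝓝[≠] b, f z ≠ f b := by
    refine (hf.analyticAt (hU.mem_nhds hb)).eventually_eq_or_eventually_ne analyticAt_const
      |>.resolve_left fun h => hne (f b) ?_
    exact (hf.analyticOnNhd hU).eqOn_of_preconnected_of_eventuallyEq analyticOnNhd_const hc hb h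
  have h1 : ∀ᶠ z in 𝓝 b, (z ≠ b → f z ≠ f b) ∧ z ∈ U ∧ z ≠ a :=
    (eventually_nhdsWithin_iff.mp hiso).and
      ((hU.eventually_mem hb).and (isOpen_ne.eventually_mem (Ne.symm hne')))
  obtain ⟨r, hr, hball⟩ := Metric.nhds_basis_closedBall.mem_iff.mp h1
  have hsub : closedBall b r ⊆ U := fun z hz => (hball hz).2.1
  obtain ⟨x, hx, hmin⟩ := (isCompact_sphere b r).exists_isMinOn
    (NormedSpace.sphere_nonempty.mpr hr.le)
    (f := fun z => ‖f z - f b‖)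
    (((hf.continuousOn.mono (sphere_subset_closedBall.trans hsub)).sub continuousOn_const).norm)
  set ε := ‖f x - f b‖ with hε
  have hε0 : 0 < ε := norm_pos_iff.mpr (sub_ne_zero.mpr
    ((hball (sphere_subset_closedBall hx)).1 (ne_of_mem_sphere hx hr.ne')))
  have hunif : TendstoUniformlyOn F f l (closedBall b r) :=
    (tendstoLocallyUniformlyOn_iff_forall_isCompact hU).mp hl _ hsub (isCompact_closedBall b r)
  have hta := Metric.tendsto_nhds.mp (hl.tendsto_at ha) (ε / 8) (by positivity)
  obtain ⟨i, hi1, hi2⟩ := ((Metric.tendstoUniformlyOn_iff.mp hunif (ε / 8) (by positivity)).and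
    hta).exists
  have hbb : b ∈ closedBall b r := mem_closedBall_self hr.le
  have hib := hi1 b hbb
  -- A quantitative open mapping theorem now makes `F i` cover the `ε / 4`-ball about `F i b` from
  -- `closedBall b r`. That ball contains `F i a`, while `a` lies outside `closedBall b r`.
  have hsphere : ∀ z ∈ sphere b r, ε / 2 ≤ ‖F i z - F i b‖ := by
    intro z hz
    have e1 := hi1 z (sphere_subset_closedBall hz)
    have e2 : ε ≤ dist (f z) (f b) := by rw [dist_eq_norm]; exact hmin hz
    have e3 := dist_triangle4 (f z) (F i z) (F i b) (f b)
    rw [dist_comm (F i b)] at e3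
    rw [← dist_eq_norm]
    linarith
  have hdc : DiffContOnCl ℂ (F i) (ball b r) :=
    ((hF i).mono (closure_ball_subset_closedBall.trans hsub)).diffContOnCl
  have hfreq : ∃ᶠ z in 𝓝 b, F i z ≠ F i b := fun h =>
    not_eventually_const_of_injOn hU (hi i) hb (F i b) (h.mono fun _ => not_not.mp)
  have hmem : F i a ∈ ball (F i b) (ε / 2 / 2) := by
    rw [mem_ball]
    have e3 := dist_triangle (F i a) (f b) (F i b)
    rw [hab] at hi2
    linarith
  obtain ⟨w, hw, hwa⟩ := hdc.ball_subset_image_closedBall hr hsphere hfreq hmem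
  exact (hball hw).2.2 (hi i (hsub hw) ha hwa)

/-- The injective holomorphic maps of `U` into the unit disk. -/
def univalentMaps (U : Set ℂ) : Set (ℂ → ℂ) :=
  {f | DifferentiableOn ℂ f U ∧ MapsTo f U (ball 0 1) ∧ InjOn f U}

theorem bddAbove_norm_deriv_univalentMaps (hU : IsOpen U) (hz₀ : z₀ ∈ U) :
    BddAbove ((fun f : ℂ → ℂ => ‖deriv f z₀‖) '' univalentMaps U) := by
  obtain ⟨R, hR, hball⟩ := Metric.isOpen_iff.mp hU z₀ hz₀
  refine ⟨2 / R, ?_⟩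
  rintro _ ⟨f, ⟨hf, hm, -⟩, rfl⟩
  refine Complex.norm_deriv_le_div_of_mapsTo_ball (hf.mono hball) (fun w hw => ?_) hR
  have h1 := mem_ball_zero_iff.mp (hm (hball hw))
  have h2 := mem_ball_zero_iff.mp (hm hz₀)
  rw [mem_closedBall, dist_eq_norm]
  linarith [norm_sub_le (f w) (f z₀)]

/-- Among the injective holomorphic maps of `U` into the disk, one has the largest derivative
at `z₀`. -/
theorem exists_isMaxOn_norm_deriv (hU : IsOpen U) (hc : IsPreconnected U) (hz₀ : z₀ ∈ U)
    (hne : (univalentMaps U).Nonempty) :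
    ∃ f ∈ univalentMaps U, IsMaxOn (fun f : ℂ → ℂ => ‖deriv f z₀‖) (univalentMaps U) f := by
  set S := (fun f : ℂ → ℂ => ‖deriv f z₀‖) '' univalentMaps U with hS
  have hbdd : BddAbove S := bddAbove_norm_deriv_univalentMaps hU hz₀
  obtain ⟨u, -, hu, huS⟩ := exists_seq_tendsto_sSup (hne.image _) hbdd
  choose F hF hFu using huS
  replace hFu : ∀ n, ‖deriv (F n) z₀‖ = u n := hFu
  -- Along an ultrafilter, bounded sequences converge at every point at once, so no diagonal
  -- subsequence is extracted.
  let l : Filter ℕ := hyperfilter ℕ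
  have hle : l ≤ atTop := by
    rw [← Nat.cofinite_eq_atTop]
    exact hyperfilter_le_cofinite
  have hlim : ∀ z, ∃ y, z ∈ U → Tendsto (F · z) l (𝓝 y) := by
    intro z
    by_cases hz : z ∈ U
    · obtain ⟨y, -, hy⟩ := (isCompact_closedBall (0 : ℂ) 1).ultrafilter_le_nhds'
        ((hyperfilter ℕ).map (F · z))
        (Ultrafilter.mem_map.mpr
          (univ_mem' fun n => ball_subset_closedBall ((hF n).2.1 hz)))
      exact ⟨y, fun _ => hy⟩
    · exact ⟨0, fun h => absurd h hz⟩
  choose f hf using hlim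
  have hloc : TendstoLocallyUniformlyOn F f l U :=
    tendstoLocallyUniformlyOn_of_mapsTo_ball hU (fun n => (hF n).1) (fun n => (hF n).2.1) hf
  have hev : ∀ᶠ n in l, DifferentiableOn ℂ (F n) U := Eventually.of_forall fun n => (hF n).1
  have hfd : DifferentiableOn ℂ f U := hloc.differentiableOn hev hU
  have hderiv : ‖deriv f z₀‖ = sSup S := by
    refine tendsto_nhds_unique ((hloc.deriv hev hU).tendsto_at hz₀).norm ?_
    refine (hu.mono_left hle).congr fun n => ?_
    rw [← hFu n]
    rfl
  have hle_max : ∀ g ∈ univalentMaps U, ‖deriv g z₀‖ ≤ ‖deriv f z₀‖ := fun g hg =>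
    hderiv ▸ le_csSup hbdd (mem_image_of_mem _ hg)
  have hpos : 0 < ‖deriv f z₀‖ := by
    obtain ⟨g, hg⟩ := hne
    exact (norm_pos_iff.mpr (deriv_ne_zero_of_injOn hU hg.1 hg.2.2 hz₀)).trans_le (hle_max g hg)
  have hnc : ∀ c, ¬ EqOn f (fun _ => c) U := by
    intro c h
    have h1 : f =ᶠ[𝓝 z₀] fun _ => c := h.eventuallyEq_of_mem (hU.mem_nhds hz₀)
    rw [h1.deriv_eq, deriv_const, norm_zero] at hpos
    exact hpos.false
  have hinj := injOn_of_tendstoLocallyUniformlyOn hU hc (fun n => (hF n).1) (fun n => (hF n).2.2)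
    hloc hnc
  refine ⟨f, ⟨hfd, fun z hz => ?_, hinj⟩, hle_max⟩
  -- The limit is only known to land in the closed disk; openness of `f` pushes its image into the
  -- interior.
  have hcl : f '' U ⊆ closedBall 0 1 := by
    rintro _ ⟨w, hw, rfl⟩
    exact isClosed_closedBall.mem_of_tendsto (hf w hw)
      (Eventually.of_forall fun n => ball_subset_closedBall ((hF n).2.1 hw))
  rw [← interior_closedBall (0 : ℂ) one_ne_zero, mem_interior_iff_mem_nhds]
  exact mem_of_superset (nhds_le_map_nhds_of_injOn hU hfd hinj hz (image_mem_map (hU.mem_nhds hz)))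
    hcl

/-- Passing to a square root strictly increases the pullback of the hyperbolic density. -/
theorem pullbackDensity_sq_lt {g : ℂ → ℂ} (hg : DifferentiableAt ℂ g z₀)
    (hm : g z₀ ∈ ball (0 : ℂ) 1) (hd : deriv g z₀ ≠ 0) :
    pullbackDensity (fun z => g z ^ 2) z₀ < pullbackDensity g z₀ := by
  have h1 := one_sub_normSq_pos hm
  have h2 := norm_pos_iff.mpr hd
  rw [mem_ball_zero_iff] at hm
  have hF : deriv (fun z => g z ^ 2) z₀ = 2 * g z₀ * deriv g z₀ := by
    simpa using (hg.hasDerivAt.fun_pow 2).deriv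
  rw [pullbackDensity, pullbackDensity, hF, diskDensity, diskDensity]
  simp only [norm_mul, norm_pow, Complex.norm_ofNat]
  set t := ‖g z₀‖
  have ht : 0 ≤ t := norm_nonneg _
  have h3 : 1 - (t ^ 2) ^ 2 = (1 - t ^ 2) * (1 + t ^ 2) := by ring
  have h4 : 2 * t / (1 + t ^ 2) < 1 := by
    rw [div_lt_one (by positivity)]
    nlinarith [sq_pos_of_pos (sub_pos.mpr hm)]
  calc _ = 1 / (1 - t ^ 2) * ‖deriv g z₀‖ * (2 * t / (1 + t ^ 2)) := by
        rw [h3]; field_simp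
    _ < _ := mul_lt_of_lt_one_right (by positivity) h4

theorem mobius_comp_mem_univalentMaps {f : ℂ → ℂ} {w : ℂ} (hU : IsOpen U) (hf : f ∈ univalentMaps U)
    (hw : w ∈ ball (0 : ℂ) 1) : mobius w ∘ f ∈ univalentMaps U := by
  obtain ⟨hd, hm, hi⟩ := hf
  refine ⟨fun z hz => ?_, fun z hz => mobius_mem_ball hw (hm hz), (injOn_mobius hw).comp hi hm⟩
  exact ((hasDerivAt_mobius hw (hm hz)).differentiableAt.comp z
    (hd.differentiableAt (hU.mem_nhds hz))).differentiableWithinAt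

/-- A zero-free holomorphic function on a simply connected open set has a holomorphic square
root. -/
theorem exists_differentiableOn_sq_eq {f : ℂ → ℂ} (hU : IsOpen U) (hc : IsSimplyConnected U)
    (hf : DifferentiableOn ℂ f U) (h0 : ∀ z ∈ U, f z ≠ 0) :
    ∃ g : ℂ → ℂ, DifferentiableOn ℂ g U ∧ ∀ z, g z ^ 2 = f z := by
  obtain ⟨g, hgc, hg⟩ := Complex.exists_continuousOn_pow_eq hc hU hf.continuousOn
    (by rintro ⟨z, hz, h⟩; exact h0 z hz h) two_ne_zero
  have hg0 : ∀ z ∈ U, g z ≠ 0 := fun z hz h => h0 z hz (by rw [← hg z, h]; simp)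
  refine ⟨g, fun z hz => ?_, hg⟩
  have hsq : HasStrictDerivAt (fun w : ℂ => w ^ 2) (2 * g z) (g z) := by
    simpa using hasStrictDerivAt_pow 2 (g z)
  have h2 : 2 * g z ≠ 0 := mul_ne_zero two_ne_zero (hg0 z hz)
  set s := hsq.localInverse _ _ _ h2
  have hcont : ContinuousAt g z := hgc.continuousAt (hU.mem_nhds hz)
  have hs : HasDerivAt s (2 * g z)⁻¹ (f z) := by
    rw [← hg z]
    exact (hsq.to_localInverse h2).hasDerivAt
  -- Continuity of `g` keeps it on the branch of the root given by `s`.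
  have hev : g =ᶠ[𝓝 z] s ∘ f := by
    filter_upwards [hcont.eventually (hsq.hasStrictFDerivAt_equiv h2).eventually_left_inverse]
      with w hw
    rw [Function.comp_apply, ← hg w]
    exact hw.symm
  exact ((hs.differentiableAt.comp z
    (hf.differentiableAt (hU.mem_nhds hz))).congr_of_eventuallyEq hev).differentiableWithinAt

/-- A univalent map without zeros on a simply connected open set has a univalent square root. -/
theorem exists_sqrt_mem_univalentMaps {f : ℂ → ℂ} (hU : IsOpen U) (hc : IsSimplyConnected U)
    (hf : f ∈ univalentMaps U) (h0 : ∀ z ∈ U, f z ≠ 0) :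
    ∃ g ∈ univalentMaps U, ∀ z, g z ^ 2 = f z := by
  obtain ⟨hd, hm, hi⟩ := hf
  obtain ⟨g, hgd, hg⟩ := exists_differentiableOn_sq_eq hU hc hd h0
  refine ⟨g, ⟨hgd, fun z hz => ?_, fun a ha b hb hab => hi ha hb ?_⟩, hg⟩
  · have h1 := mem_ball_zero_iff.mp (hm hz)
    rw [← hg z, norm_pow] at h1
    rw [mem_ball_zero_iff]
    nlinarith [norm_nonneg (g z)]
  · rw [← hg a, ← hg b, hab]

/-- A branch `g` of the square root of `z - a` never takes both a value and its negative. Its image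
contains a disk about `g x`, hence avoids the opposite disk about `-g x`; inverting about `-g x`
gives a bounded univalent map. -/
theorem univalentMaps_nonempty (hU : IsOpen U) (hc : IsSimplyConnected U) (hne : U ≠ univ) :
    (univalentMaps U).Nonempty := by
  obtain ⟨a, ha⟩ := (ne_univ_iff_exists_notMem U).mp hne
  obtain ⟨g, hgd, hg⟩ := exists_differentiableOn_sq_eq hU hc (f := fun z => z - a)
    (differentiableOn_id.sub_const a) (fun z hz h => ha (sub_eq_zero.mp h ▸ hz))
  have hg0 : ∀ z ∈ U, g z ≠ 0 := by
    intro z hz h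
    have h1 := hg z
    rw [h, zero_pow two_ne_zero, eq_comm, sub_eq_zero] at h1
    exact ha (h1 ▸ hz)
  have hsq : ∀ z w, g z ^ 2 = g w ^ 2 → z = w := fun z w h => by
    rw [hg, hg] at h
    exact sub_left_injective h
  have hgi : InjOn g U := fun z _ w _ h => hsq z w (by rw [h])
  obtain ⟨x, hx⟩ := hc.nonempty
  obtain ⟨ε, hε, hball⟩ := Metric.mem_nhds_iff.mp
    (nhds_le_map_nhds_of_injOn hU hgd hgi hx (image_mem_map (hU.mem_nhds hx)))
  have hfar : ∀ z ∈ U, ε ≤ ‖g z + g x‖ := by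
    intro z hz
    by_contra! hlt
    have h1 : -g z ∈ ball (g x) ε := by
      rwa [mem_ball, dist_eq_norm, ← norm_neg, show -(-g z - g x) = g z + g x by ring]
    obtain ⟨y, -, hy⟩ := hball h1
    have hyz : y = z := hsq y z (by rw [hy, neg_sq])
    rw [hyz] at hy
    exact hg0 z hz (self_eq_neg.mp hy)
  have hne0 : ∀ z ∈ U, g z + g x ≠ 0 := fun z hz => norm_pos_iff.mp (hε.trans_le (hfar z hz))
  have hc0 : ((ε / 2 : ℝ) : ℂ) ≠ 0 := Complex.ofReal_ne_zero.mpr (half_pos hε).ne'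
  refine ⟨fun z => (ε / 2 : ℝ) / (g z + g x), ?_, fun z hz => ?_, fun z hz w hw h => ?_⟩
  · exact (differentiableOn_const _).div (hgd.add_const _) hne0
  · rw [mem_ball_zero_iff, norm_div, Complex.norm_real, Real.norm_of_nonneg (half_pos hε).le,
      div_lt_one (norm_pos_iff.mpr (hne0 z hz))]
    exact (half_lt_self hε).trans_le (hfar z hz)
  · have h1 := mul_left_cancel₀ hc0 ((div_eq_mul_inv _ _).symm.trans (h.trans (div_eq_mul_inv _ _)))
    exact hgi hz hw (add_right_cancel (inv_injective h1))

/-- The **Riemann mapping theorem**. -/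
theorem exists_isConformalOntoDisk (hU : IsOpen U) (hc : IsSimplyConnected U) (hne : U ≠ univ) :
    ∃ φ : ℂ → ℂ, IsConformalOntoDisk U φ := by
  obtain ⟨z₀, hz₀⟩ := hc.nonempty
  obtain ⟨f, hf, hmax⟩ := exists_isMaxOn_norm_deriv hU hc.isPathConnected.isConnected.isPreconnected
    hz₀ (univalentMaps_nonempty hU hc hne)
  refine ⟨f, hf.1, hf.2.1, hf.2.2, ?_⟩
  by_contra hsurj
  obtain ⟨w, hw, hwf⟩ := not_subset.mp hsurj
  have hfd := hf.1.differentiableAt (hU.mem_nhds hz₀)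
  have hfz := hf.2.1 hz₀
  have hT := mobius_comp_mem_univalentMaps hU hf hw
  have hT0 : ∀ z ∈ U, (mobius w ∘ f) z ≠ 0 := fun z hz h =>
    hwf ⟨z, hz, injOn_mobius hw (hf.2.1 hz) hw (h.trans (mobius_self w).symm)⟩
  obtain ⟨g, hg, hsq⟩ := exists_sqrt_mem_univalentMaps hU hc hT hT0
  have hgd := hg.1.differentiableAt (hU.mem_nhds hz₀)
  have hgz := hg.2.1 hz₀
  have h1 := pullbackDensity_sq_lt hgd hgz (deriv_ne_zero_of_injOn hU hg.1 hg.2.2 hz₀)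
  rw [show (fun z => g z ^ 2) = mobius w ∘ f from funext hsq, pullbackDensity_mobius_comp hw hfz hfd,
    ← pullbackDensity_mobius_comp hgz hgz hgd] at h1
  have h2 : pullbackDensity (mobius (g z₀) ∘ g) z₀ = ‖deriv (mobius (g z₀) ∘ g) z₀‖ := by
    simp [pullbackDensity, mobius_self, diskDensity]
  -- An inequality suffices, so the maximiser need not be normalised by `f z₀ = 0`.
  have h3 : ‖deriv f z₀‖ ≤ pullbackDensity f z₀ := by
    refine le_mul_of_one_le_left (norm_nonneg _) ?_
    rw [diskDensity, le_div_iff₀ (one_sub_normSq_pos hfz)]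
    linarith [sq_nonneg ‖f z₀‖]
  have h4 : ‖deriv (mobius (g z₀) ∘ g) z₀‖ ≤ ‖deriv f z₀‖ :=
    hmax (mobius_comp_mem_univalentMaps hU hg hgz)
  linarith

end RiemannMapping

/-! ### Monotonicity of the hyperbolic density and of the Bloch norm -/

section Monotone

variable {Ω Ω₁ Ω₂ : Set ℂ} {α : ℝ} {f : ℂ → ℂ} {z : ℂ}

theorem IsProperSimplyConnectedDomain.exists_hyperbolicDensity_eq
    (h : IsProperSimplyConnectedDomain Ω) :
    ∃ φ : ℂ → ℂ, IsConformalOntoDisk Ω φ ∧ ∀ z, hyperbolicDensity Ω z = pullbackDensity φ z := by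
  have hex := exists_isConformalOntoDisk h.isOpen h.isSimplyConnected h.ne_univ
  refine ⟨hex.choose, hex.choose_spec, fun z => ?_⟩
  rw [hyperbolicDensity, dif_pos hex, pullbackDensity]

theorem IsProperSimplyConnectedDomain.hyperbolicDensity_pos (h : IsProperSimplyConnectedDomain Ω)
    (hz : z ∈ Ω) : 0 < hyperbolicDensity Ω z := by
  obtain ⟨φ, ⟨hd, hb⟩, hφ⟩ := h.exists_hyperbolicDensity_eq
  rw [hφ, pullbackDensity]
  exact mul_pos (diskDensity_pos (hb.mapsTo hz))
    (norm_pos_iff.mpr (deriv_ne_zero_of_injOn h.isOpen hd hb.injOn hz))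

/-- A holomorphic map of `Ω` into the disk contracts the hyperbolic metric. -/
theorem IsConformalOntoDisk.pullbackDensity_le {φ : ℂ → ℂ} (hΩ : IsOpen Ω)
    (hφ : IsConformalOntoDisk Ω φ) (hf : DifferentiableOn ℂ f Ω) (hm : MapsTo f Ω (ball 0 1))
    (hz : z ∈ Ω) : pullbackDensity f z ≤ pullbackDensity φ z := by
  obtain ⟨hd, hb⟩ := hφ
  set ψ := f ∘ Function.invFunOn φ Ω with hψ
  have hmaps : ∀ w ∈ ball (0 : ℂ) 1, Function.invFunOn φ Ω w ∈ Ω := fun w hw =>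
    Function.invFunOn_mem (hb.surjOn hw)
  have hψd : DifferentiableOn ℂ ψ (ball 0 1) := by
    intro w hw
    have h1 : DifferentiableAt ℂ (Function.invFunOn φ Ω) w := by
      have := differentiableAt_invFunOn hΩ hd hb.injOn (hmaps w hw)
      rwa [Function.invFunOn_eq (hb.surjOn hw)] at this
    exact ((hf.differentiableAt (hΩ.mem_nhds (hmaps w hw))).comp w h1).differentiableWithinAt
  have hψm : MapsTo ψ (ball 0 1) (ball 0 1) := fun w hw => hm (hmaps w hw)
  have hφz := hb.mapsTo hz
  have hev : f =ᶠ[𝓝 z] ψ ∘ φ := by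
    filter_upwards [invFunOn_eventually_leftInverse hΩ hb.injOn hz] with w hw
    simp [hψ, hw]
  have h2 : pullbackDensity f z = pullbackDensity (ψ ∘ φ) z := by
    rw [pullbackDensity, hev.deriv_eq, hev.self_of_nhds, pullbackDensity]
  rw [h2, pullbackDensity_comp (hψd.differentiableAt (isOpen_ball.mem_nhds hφz))
    (hd.differentiableAt (hΩ.mem_nhds hz))]
  exact mul_le_mul_of_nonneg_right (pullbackDensity_le_diskDensity hψd hψm hφz) (norm_nonneg _)

/-- Domain monotonicity of the hyperbolic density. -/
theorem hyperbolicDensity_anti (h₁ : IsProperSimplyConnectedDomain Ω₁)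
    (h₂ : IsProperSimplyConnectedDomain Ω₂) (h : Ω₁ ⊆ Ω₂) (hz : z ∈ Ω₁) :
    hyperbolicDensity Ω₂ z ≤ hyperbolicDensity Ω₁ z := by
  obtain ⟨φ₁, hc₁, hφ₁⟩ := h₁.exists_hyperbolicDensity_eq
  obtain ⟨φ₂, ⟨hd₂, hb₂⟩, hφ₂⟩ := h₂.exists_hyperbolicDensity_eq
  rw [hφ₁, hφ₂]
  exact hc₁.pullbackDensity_le h₁.isOpen (hd₂.mono h) (hb₂.mapsTo.mono_left h) hz

theorem blochQuotient_mono (hα : 0 ≤ α) (h₁ : IsProperSimplyConnectedDomain Ω₁)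
    (h₂ : IsProperSimplyConnectedDomain Ω₂) (h : Ω₁ ⊆ Ω₂) (hz : z ∈ Ω₁) :
    blochQuotient Ω₁ α f z ≤ blochQuotient Ω₂ α f z := by
  -- A zero density would make the right-hand quotient `0` by convention when `α ≠ 0`.
  have hpos := h₂.hyperbolicDensity_pos (h hz)
  exact div_le_div_of_nonneg_left (norm_nonneg _) (Real.rpow_pos_of_pos hpos α)
    (Real.rpow_le_rpow hpos.le (hyperbolicDensity_anti h₁ h₂ h hz) hα)

theorem blochSpace_anti (hα : 0 ≤ α) (h₁ : IsProperSimplyConnectedDomain Ω₁)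
    (h₂ : IsProperSimplyConnectedDomain Ω₂) (h : Ω₁ ⊆ Ω₂) :
    blochSpace Ω₂ α ⊆ blochSpace Ω₁ α := by
  rintro f ⟨hd, C, hC⟩
  refine ⟨hd.mono h, C, ?_⟩
  rintro _ ⟨z, hz, rfl⟩
  exact (blochQuotient_mono hα h₁ h₂ h hz).trans (hC (mem_image_of_mem _ (h hz)))

/-- Membership of `f` in the larger domain's space gives the bound without which `sSup` could
default to `0`. -/
theorem blochNorm_mono (hα : 0 ≤ α) (h₁ : IsProperSimplyConnectedDomain Ω₁)
    (h₂ : IsProperSimplyConnectedDomain Ω₂) (h : Ω₁ ⊆ Ω₂) (hf : f ∈ blochSpace Ω₂ α) :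
    blochNorm Ω₁ α f ≤ blochNorm Ω₂ α f := by
  refine add_le_add_right (csSup_le (h₁.isSimplyConnected.nonempty.image _) ?_) _
  rintro _ ⟨z, hz, rfl⟩
  exact (blochQuotient_mono hα h₁ h₂ h hz).trans (le_csSup hf.2 (mem_image_of_mem _ (h hz)))

theorem IsBlochBohrRadius.mono {r₁ r₂ : ℝ} (hα : 0 ≤ α) (h₁ : IsProperSimplyConnectedDomain Ω₁)
    (h₂ : IsProperSimplyConnectedDomain Ω₂) (h : Ω₁ ⊆ Ω₂) (hr₁ : IsBlochBohrRadius Ω₁ α r₁)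
    (hr₂ : IsBlochBohrRadius Ω₂ α r₂) : r₁ ≤ r₂ := by
  obtain ⟨⟨h0, h1, hB⟩, -⟩ := hr₁
  exact hr₂.2 ⟨h0, h1, fun f hf hn => hB f (blochSpace_anti hα h₁ h₂ h hf)
    ((blochNorm_mono hα h₁ h₂ h hf).trans hn)⟩

end Monotone

end BlochBohr

theorem corollary4p3 (α : ℝ) (hα : 0 < α) :
    (∀ (Ω₁ Ω₂ : Set ℂ) (r₁ r₂ : ℝ),
      BlochBohr.IsProperSimplyConnectedDomain Ω₁ →
      BlochBohr.IsProperSimplyConnectedDomain Ω₂ →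
      Metric.ball (0 : ℂ) 1 ⊆ Ω₁ →
      Metric.ball (0 : ℂ) 1 ⊆ Ω₂ →
      Ω₁ ⊆ Ω₂ →
      BlochBohr.IsBlochBohrRadius Ω₁ α r₁ →
      BlochBohr.IsBlochBohrRadius Ω₂ α r₂ →
      r₁ ≤ r₂) ∧
    (∀ (n : ℕ) (Ω : Fin n → Set ℂ) (r : Fin n → ℝ),
      (∀ i, BlochBohr.IsProperSimplyConnectedDomain (Ω i)) →
      (∀ i, Metric.ball (0 : ℂ) 1 ⊆ Ω i) →
      Monotone Ω →
      (∀ i, BlochBohr.IsBlochBohrRadius (Ω i) α (r i)) →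
      Monotone r) :=
  ⟨fun _ _ _ _ h₁ h₂ _ _ h hr₁ hr₂ => hr₁.mono hα.le h₁ h₂ h hr₂,
    fun _ _ _ hΩ _ hmono hr i j hij => (hr i).mono hα.le (hΩ i) (hΩ j) (hmono hij) (hr j)⟩
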